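/- All Banach spaces are real and non-zero. For a Banach space $X$, regard $X$ as a subspace of its bidual $X^{**}$ through the canonical embedding. $X$ is called reflexive if this embedding is onto, and $L$-embedded if there is a linear subspace $Z\subseteq X^{**}$ with $X^{**}=X\oplus_1 Z$, i.e. $X^{**}$ is the algebraic direct sum of $X$ and $Z$ and $\|x+z\|=\|x\|+\|z\|$ for all $x\in X$, $z\in Z$. A Banach space $W$ has the metric approximation property if there is a net $(S_\alpha)$ of finite-rank bounded linear operators on $W$ with $\|S_\alpha\|\le 1$ for all $\alpha$ and $S_\alpha w\to w$ for every $w\in W$. The norm of a Banach space $W$ is octahedral if for every finite-dimensional subspace $E\subseteq W$ and every $\varepsilon>0$ there is $y\in W$ with $\|y\|=1$ such that $$\|x+\lambda y\|\ge(1-\varepsilon)(\|x\|+|\lambda|)\qquad\text{for all }x\in E,\ \lambda\in\mathbb R.$$ The projective tensor product $X\widehat{\otimes}_\pi Y$ is the completion of the algebraic tensor product $X\otimes Y$ for the norm $\pi(u)=\inf\{\sum_{i=1}^n\|x_i\|\,\|y_i\| : u=\sum_{i=1}^n x_i\otimes y_i\}$. **Theorem.** Let $X$ be a non-reflexive $L$-embedded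 Banach space and let $Y$ be a non-zero Banach space. If $X^{**}$ or $Y$ has the metric approximation property, then the norm of $X\widehat{\otimes}_\pi Y$ is octahedral. -/

import Mathlib

open scoped TensorProduct Topology

universe u

noncomputable section

namespace BanachTensor

/-- The norm of `X` is octahedral: for every finite-dimensional subspace `E` of `X` and every
`ε > 0` there is `y` in the unit sphere of `X` such that
`‖x + t • y‖ ≥ (1 - ε) (‖x‖ + |t|)` for all `x ∈ E` and all real `t`. -/
def IsOctahedral (X : Type*) [NormedAddCommGroup X] [NormedSpace ℝ X] : Prop :=
  ∀ E : Submodule ℝ X, FiniteDimensional ℝ E → ∀ ε : ℝ, 0 < ε →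
    ∃ y : X, ‖y‖ = 1 ∧ ∀ x ∈ E, ∀ t : ℝ, (1 - ε) * (‖x‖ + |t|) ≤ ‖x + t • y‖

/-- The bidual of `X`, with its dual norm. -/
abbrev Bidual (X : Type*) [NormedAddCommGroup X] [NormedSpace ℝ X] : Type _ :=
  StrongDual ℝ (StrongDual ℝ X)

/-- `X` is reflexive: the canonical embedding of `X` into its bidual is onto. -/
def IsReflexive (X : Type*) [NormedAddCommGroup X] [NormedSpace ℝ X] : Prop :=
  Function.Surjective (NormedSpace.inclusionInDoubleDual ℝ X)

/-- `X` is `L`-embedded: there is a subspace `Z` of the bidual such that the bidual is the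
`ℓ₁`-direct sum of (the canonical copy of) `X` and `Z`. -/
def IsLEmbedded (X : Type*) [NormedAddCommGroup X] [NormedSpace ℝ X] : Prop :=
  ∃ Z : Submodule ℝ (Bidual X),
    IsCompl (LinearMap.range (NormedSpace.inclusionInDoubleDual ℝ X).toLinearMap) Z ∧
    ∀ x : X, ∀ z ∈ Z, ‖NormedSpace.inclusionInDoubleDual ℝ X x + z‖ =
      ‖NormedSpace.inclusionInDoubleDual ℝ X x‖ + ‖z‖

/-- `X` has the metric approximation property: there is a net `S` of finite rank operators on
`X`, of norm at most `1`, with `S α x → x` for every `x`. (Restricting the index set to the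
universe of `X` loses nothing, since a net can be re-indexed by `Finset X × ℕ`.) -/
def HasMAP (X : Type u) [NormedAddCommGroup X] [NormedSpace ℝ X] : Prop :=
  ∃ (ι : Type u) (_ : Preorder ι) (_ : IsDirected ι (· ≤ ·)) (_ : Nonempty ι)
    (S : ι → X →L[ℝ] X),
    (∀ α, FiniteDimensional ℝ (LinearMap.range (S α).toLinearMap)) ∧
    (∀ α, ‖S α‖ ≤ 1) ∧
    ∀ x : X, Filter.Tendsto (fun α => S α x) Filter.atTop (𝓝 x)

section Projective

variable (X Y : Type*) [NormedAddCommGroup X] [NormedSpace ℝ X]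
  [NormedAddCommGroup Y] [NormedSpace ℝ Y]

/-- The algebraic tensor product of `X` and `Y`, as a copy to be given the projective norm. -/
def ProjAlg : Type _ := X ⊗[ℝ] Y

instance : AddCommGroup (ProjAlg X Y) := inferInstanceAs (AddCommGroup (X ⊗[ℝ] Y))

instance : Module ℝ (ProjAlg X Y) := inferInstanceAs (Module ℝ (X ⊗[ℝ] Y))

variable {X Y}

/-- The values `∑ i, ‖x i‖ * ‖y i‖` over all representations `u = ∑ i, x i ⊗ y i`. -/
def projCosts (u : X ⊗[ℝ] Y) : Set ℝ :=
  {r | ∃ (n : ℕ) (x : Fin n → X) (y : Fin n → Y),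
    u = ∑ i, x i ⊗ₜ[ℝ] y i ∧ r = ∑ i, ‖x i‖ * ‖y i‖}

/-- The projective norm `π(u) = inf {∑ i, ‖x i‖ ‖y i‖ : u = ∑ i, x i ⊗ y i}`. -/
def projNorm (u : X ⊗[ℝ] Y) : ℝ := sInf (projCosts u)

lemma projCosts_nonneg {u : X ⊗[ℝ] Y} {r : ℝ} (h : r ∈ projCosts u) : 0 ≤ r := by
  obtain ⟨n, x, y, -, rfl⟩ := h
  positivity

lemma projCosts_bddBelow (u : X ⊗[ℝ] Y) : BddBelow (projCosts u) :=
  ⟨0, fun _ h => projCosts_nonneg h⟩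

lemma projCosts_zero : (0 : ℝ) ∈ projCosts (0 : X ⊗[ℝ] Y) :=
  ⟨0, Fin.elim0, Fin.elim0, by simp, by simp⟩

lemma projCosts_add {u v : X ⊗[ℝ] Y} {r s : ℝ} (hr : r ∈ projCosts u) (hs : s ∈ projCosts v) :
    r + s ∈ projCosts (u + v) := by
  obtain ⟨n, x, y, rfl, rfl⟩ := hr
  obtain ⟨m, x', y', rfl, rfl⟩ := hs
  exact ⟨n + m, Fin.append x x', Fin.append y y', by simp [Fin.sum_univ_add],
    by simp [Fin.sum_univ_add]⟩

lemma projCosts_smul (c : ℝ) {u : X ⊗[ℝ] Y} {r : ℝ} (hr : r ∈ projCosts u) :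
    |c| * r ∈ projCosts (c • u) := by
  obtain ⟨n, x, y, rfl, rfl⟩ := hr
  exact ⟨n, fun i => c • x i, y, by simp [Finset.smul_sum, TensorProduct.smul_tmul'],
    by simp [Finset.mul_sum, norm_smul, mul_assoc]⟩

lemma projCosts_nonempty (u : X ⊗[ℝ] Y) : (projCosts u).Nonempty := by
  induction u using TensorProduct.induction_on with
  | zero => exact ⟨0, projCosts_zero⟩
  | tmul x y => exact ⟨‖x‖ * ‖y‖, 1, fun _ => x, fun _ => y, by simp, by simp⟩
  | add u v hu hv =>
    obtain ⟨r, hr⟩ := hu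
    obtain ⟨s, hs⟩ := hv
    exact ⟨r + s, projCosts_add hr hs⟩

lemma projNorm_zero : projNorm (0 : X ⊗[ℝ] Y) = 0 :=
  le_antisymm (csInf_le (projCosts_bddBelow _) projCosts_zero)
    (le_csInf (projCosts_nonempty _) fun _ h => projCosts_nonneg h)

lemma projNorm_add_le (u v : X ⊗[ℝ] Y) : projNorm (u + v) ≤ projNorm u + projNorm v := by
  refine le_of_forall_pos_le_add fun ε hε => ?_
  obtain ⟨r, hr, hr'⟩ := Real.lt_sInf_add_pos (projCosts_nonempty u) (half_pos hε)
  obtain ⟨s, hs, hs'⟩ := Real.lt_sInf_add_pos (projCosts_nonempty v) (half_pos hε)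
  have h := csInf_le (projCosts_bddBelow _) (projCosts_add hr hs)
  unfold projNorm
  linarith

lemma projNorm_smul_le (c : ℝ) (u : X ⊗[ℝ] Y) : projNorm (c • u) ≤ ‖c‖ * projNorm u := by
  rw [Real.norm_eq_abs]
  refine le_of_forall_pos_le_add fun ε hε => ?_
  have hc : 0 < |c| + 1 := by positivity
  obtain ⟨r, hr, hr'⟩ := Real.lt_sInf_add_pos (projCosts_nonempty u) (div_pos hε hc)
  have h := csInf_le (projCosts_bddBelow _) (projCosts_smul c hr)
  have h1 : |c| * r ≤ |c| * (sInf (projCosts u) + ε / (|c| + 1)) :=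
    mul_le_mul_of_nonneg_left hr'.le (abs_nonneg c)
  have h2 : |c| * (ε / (|c| + 1)) ≤ ε := by
    rw [mul_div_assoc', div_le_iff₀ hc]
    nlinarith
  unfold projNorm
  linarith

variable (X Y)

/-- The projective norm, as a seminorm on the algebraic tensor product. -/
def projSeminorm : Seminorm ℝ (ProjAlg X Y) :=
  Seminorm.ofSMulLE (fun u => projNorm (X := X) (Y := Y) u) projNorm_zero projNorm_add_le
    projNorm_smul_le

instance : SeminormedAddCommGroup (ProjAlg X Y) :=
  (projSeminorm X Y).toAddGroupSeminorm.toSeminormedAddCommGroup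

instance : NormedSpace ℝ (ProjAlg X Y) where
  norm_smul_le := projNorm_smul_le (X := X) (Y := Y)

/-- The projective tensor product of `X` and `Y`: the completion of the algebraic tensor product
for the projective norm. -/
abbrev ProjTensor : Type _ := UniformSpace.Completion (ProjAlg X Y)

end Projective

end BanachTensor

end

/-!
The idea is to find the octahedral direction first in the bidual, as `u ⊗ y₀` with `u` a unit vector
of the complement `Z` of `X`, and then to move it down to `X ⊗ Y`.

Write `P` and `Q` for the projections of `X** = X ⊕₁ Z` onto `X` and `Z`; since `X` is not
reflexive, there is a unit vector `u ∈ Z`. Let `w ∈ X ⊗ Y`. By Hahn–Banach there is a contraction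
`B : Y → X*` with `⟨B, w⟩ = π(w)` (`exists_pairing_eq_projNorm`). Let `y₀ ∈ Y` be a unit vector,
`g ∈ Y*` and `ζ ∈ X***` of norm at most one with `g(y₀) = 1` and `ζ(u) = 1`. Because the sum of `X`
and `Z` is an `ℓ₁`-sum, `G(y)(v) = B(y)(P v) + g(y) ζ(Q v)` defines a contraction `G : Y → X***`; it
restricts to `B` on `X` and `G(y₀)(u) = 1` (`exists_extension_of_isLEmbedded`).

The metric approximation property of `X**` or of `Y` replaces `G` by contractions of finite rank
with almost the same values on finitely many pairs `(y, v)`. A finite rank contraction into a bidual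
`V**` can in turn be approximated, on finitely many pairs in `Y × V*`, by contractions into `V`
(`finiteRank_mem_closure`), a weak form of the principle of local reflexivity. For `V = X*` this
gives a contraction `T : Y → X*` with `⟨T, w⟩ ≈ π(w)` and `u(T y₀) ≈ 1`. For finitely many `w` one
obtains finitely many such `T`, and Goldstine's theorem gives one `x` in the unit ball of `X` with
`T(y₀)(x) ≈ 1` for all of them; hence `π(w + x ⊗ y₀) ≥ ⟨T, w + x ⊗ y₀⟩ ≈ π(w) + 1`
(`exists_projNorm_add_tmul_ge`). That such directions exist for finite subsets of a dense set is
enough for octahedrality, by compactness of the unit spheres of finite-dimensional subspaces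
(`isOctahedral_of_dense`).

The weak local reflexivity principle is a separation argument. A functional
`R ↦ ∑ i, φ i (R (f i))` on operators `R : F → V`, with `F` finite-dimensional, is extended by
Hahn–Banach to `Vᵗ`, where `t` is a finite net of the unit ball of `F`; its bound thus becomes a
bound for the projective norm of the tensor `∑ i, f i ⊗ φ i`, and therefore for the pairing of that
tensor with any contraction `F → V**` (`trace_le_of_forall`).
-/

noncomputable section

-- Instances on spaces of operators into a bidual are nested deeper than the default allows.
set_option maxSynthPendingDepth 3

namespace BanachTensor

/-! ### Approximating finite rank operators into a bidual -/

section LocalReflexivity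

variable {F V Y : Type*} [NormedAddCommGroup F] [NormedSpace ℝ F]
  [NormedAddCommGroup V] [NormedSpace ℝ V] [NormedAddCommGroup Y] [NormedSpace ℝ Y]

/-- The finite set is an `η`-net of the unit ball; it almost computes operator norms, whatever the
target space. -/
lemma exists_finite_almost_norming [FiniteDimensional ℝ F] {η : ℝ} (hη : 0 < η) :
    ∃ t : Finset F, (∀ f ∈ t, ‖f‖ ≤ 1) ∧ ∀ (R : F →L[ℝ] V) (M : ℝ), 0 ≤ M →
      (∀ f ∈ t, ‖R f‖ ≤ M) → (1 - η) * ‖R‖ ≤ M := by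
  have : ProperSpace F := FiniteDimensional.proper_real F
  obtain ⟨t, hts, htf, hcov⟩ :=
    (isCompact_closedBall (0 : F) 1).finite_cover_balls hη
  refine ⟨htf.toFinset, fun f hf => by simpa using hts (htf.mem_toFinset.1 hf), ?_⟩
  intro R M hM h
  have key : ‖R‖ ≤ M + η * ‖R‖ := by
    refine R.opNorm_le_of_unit_norm (by positivity) fun x hx => ?_
    have hx' : x ∈ Metric.closedBall (0 : F) 1 := by simp [hx]
    obtain ⟨f, hf, hxf⟩ := Set.mem_iUnion₂.1 (hcov hx')
    have h1 : ‖R (x - f)‖ ≤ ‖R‖ * η :=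
      R.le_opNorm_of_le (by simpa [dist_eq_norm] using (Metric.mem_ball.1 hxf).le)
    calc ‖R x‖ = ‖R f + R (x - f)‖ := by simp
      _ ≤ M + η * ‖R‖ := by
        refine (norm_add_le _ _).trans ?_
        linarith [h f (htf.mem_toFinset.2 hf)]
  linarith

/-- The dual norm of the sup norm on `κ → V` dominates `∑ k, ‖g k‖`, where `g k` is the `k`-th
component of `g`; here `‖g k‖` is tested against a bidual vector `f k`. -/
lemma sum_bidual_le {κ : Type*} [Fintype κ] [DecidableEq κ] (g : (κ → V) →L[ℝ] ℝ)
    (f : κ → Bidual V) (hf : ∀ k, ‖f k‖ ≤ 1) :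
    ∑ k, f k (g ∘L ContinuousLinearMap.single ℝ (fun _ => V) k) ≤ ‖g‖ := by
  refine le_of_forall_pos_le_add fun ε hε => ?_
  set ψ : κ → StrongDual ℝ V := fun k => g ∘L ContinuousLinearMap.single ℝ (fun _ => V) k
  have hc : (0 : ℝ) < Fintype.card κ + 1 := by positivity
  have hex : ∀ k, ∃ v : V, ‖v‖ ≤ 1 ∧ ‖ψ k‖ - ε / (Fintype.card κ + 1) ≤ ψ k v := by
    intro k
    by_contra! hcon
    have hpos : 0 < ε / (Fintype.card κ + 1) := by positivity
    have h0 := hcon 0 (by simp)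
    have : ‖ψ k‖ ≤ ‖ψ k‖ - ε / (Fintype.card κ + 1) := by
      refine (ψ k).opNorm_le_of_unit_norm (by simpa using h0.le) fun x hx => ?_
      rw [Real.norm_eq_abs, abs_le]
      have h1 := hcon x hx.le
      have h2 := hcon (-x) (by simp [hx])
      rw [map_neg] at h2
      constructor <;> linarith
    linarith
  choose v hv1 hv2 using hex
  have hsum : ∑ k, ψ k (v k) = g v := by
    simp only [ψ, ContinuousLinearMap.comp_apply, ContinuousLinearMap.single_apply]
    rw [← map_sum, Finset.univ_sum_single]
  have hgv : g v ≤ ‖g‖ :=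
    (le_abs_self _).trans (by
      simpa using g.le_opNorm_of_le ((pi_norm_le_iff_of_nonneg zero_le_one).2 hv1))
  have hle : ∀ k, f k (ψ k) ≤ ψ k (v k) + ε / (Fintype.card κ + 1) := by
    intro k
    have h1 : f k (ψ k) ≤ ‖ψ k‖ := (le_abs_self _).trans (by
      simpa using (f k).le_of_opNorm_le (hf k) (ψ k))
    linarith [hv2 k]
  calc ∑ k, f k (ψ k) ≤ ∑ k, (ψ k (v k) + ε / (Fintype.card κ + 1)) :=
        Finset.sum_le_sum fun k _ => hle k
    _ = g v + Fintype.card κ * (ε / (Fintype.card κ + 1)) := by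
        rw [Finset.sum_add_distrib, hsum]; simp
    _ ≤ ‖g‖ + ε := by
        have : Fintype.card κ * (ε / (Fintype.card κ + 1)) ≤ ε := by
          rw [mul_div_assoc', div_le_iff₀ hc]; nlinarith
        linarith

lemma sum_apply_eq_sum_basis {μ β : Type*} [Fintype μ] [Fintype β] (b : Module.Basis β ℝ F)
    (j : F →L[ℝ] Bidual V) (e : μ → F) (θ : μ → StrongDual ℝ V) :
    ∑ i, j (e i) (θ i) = ∑ m, j (b m) (∑ i, b.repr (e i) m • θ i) := by
  simp only [map_sum, map_smul, smul_eq_mul]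
  rw [Finset.sum_comm]
  refine Finset.sum_congr rfl fun i _ => ?_
  have h : j (e i) = ∑ m, b.repr (e i) m • j (b m) := by
    conv_lhs => rw [← b.sum_repr (e i)]
    simp only [map_sum, map_smul]
  simp [h]

/-- Operators `F → V` separate the points of `F ⊗ V*`: two representations of a tensor that agree as
functionals on these operators also have the same pairing with an operator into the bidual. -/
lemma trace_eq_of_forall [FiniteDimensional ℝ F] (j : F →L[ℝ] Bidual V)
    {ι κ : Type*} [Fintype ι] [Fintype κ] (f : ι → F) (φ : ι → StrongDual ℝ V)
    (f' : κ → F) (φ' : κ → StrongDual ℝ V)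
    (h : ∀ R : F →L[ℝ] V, ∑ i, φ i (R (f i)) = ∑ k, φ' k (R (f' k))) :
    ∑ i, j (f i) (φ i) = ∑ k, j (f' k) (φ' k) := by
  let b := Module.finBasis ℝ F
  have hb : ∀ m, ∑ i, b.repr (f i) m • φ i = ∑ k, b.repr (f' k) m • φ' k := by
    intro m
    ext v
    simpa using h ((LinearMap.toContinuousLinearMap (b.coord m)).smulRight v)
  rw [sum_apply_eq_sum_basis b j f, sum_apply_eq_sum_basis b j f']
  simp only [hb]

/-- The pairing of a tensor in `F ⊗ V*`, `F` finite-dimensional, with a contraction `F → V**` is at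
most its supremum over the contractions `F → V`. -/
lemma trace_le_of_forall [FiniteDimensional ℝ F] (j : F →L[ℝ] Bidual V) (hj : ‖j‖ ≤ 1)
    {ι : Type*} [Fintype ι] (f : ι → F) (φ : ι → StrongDual ℝ V) {s : ℝ}
    (h : ∀ R : F →L[ℝ] V, ‖R‖ ≤ 1 → ∑ i, φ i (R (f i)) ≤ s) :
    ∑ i, j (f i) (φ i) ≤ s := by
  classical
  have hs : 0 ≤ s := by simpa using h 0 (by simp)
  let τ : (F →L[ℝ] V) →ₗ[ℝ] ℝ :=
    { toFun := fun R => ∑ i, φ i (R (f i))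
      map_add' := fun R S => by simp [Finset.sum_add_distrib]
      map_smul' := fun c R => by simp [Finset.mul_sum] }
  have hτ : ∀ R, |τ R| ≤ s * ‖R‖ := by
    have h1 : ∀ R, τ R ≤ s * ‖R‖ := by
      intro R
      rcases eq_or_ne R 0 with rfl | hR
      · simp
      · have hn : 0 < ‖R‖ := norm_pos_iff.2 hR
        have h2 : τ (‖R‖⁻¹ • R) ≤ s := h _ (by
          rw [norm_smul, norm_inv, norm_norm, inv_mul_cancel₀ hn.ne'])
        rw [map_smul, smul_eq_mul, inv_mul_le_iff₀ hn] at h2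
        linarith
    intro R
    have h2 := h1 (-R)
    rw [map_neg, norm_neg] at h2
    exact abs_le.2 ⟨by linarith, h1 R⟩
  -- A net of mesh `η` costs a factor `1 - η`, which disappears as `η → 0`.
  have main : ∀ η : ℝ, 0 < η → η < 1 → (1 - η) * ∑ i, j (f i) (φ i) ≤ s := by
    intro η hη hη1
    obtain ⟨t, ht1, ht⟩ := exists_finite_almost_norming (F := F) (V := V) hη
    -- Evaluation on the net embeds the operators `F → V` almost isometrically into `t → V`.
    let Ψ : (F →L[ℝ] V) →ₗ[ℝ] (t → V) :=
      { toFun := fun R k => R k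
        map_add' := fun R S => rfl
        map_smul' := fun c R => rfl }
    have hΨ : ∀ R, (1 - η) * ‖R‖ ≤ ‖Ψ R‖ := fun R =>
      ht R _ (norm_nonneg _) fun x hx => norm_le_pi_norm (Ψ R) ⟨x, hx⟩
    have hinj : Function.Injective Ψ := by
      rw [← LinearMap.ker_eq_bot, LinearMap.ker_eq_bot']
      intro R hR
      have := hΨ R
      rw [hR, norm_zero] at this
      exact norm_le_zero_iff.1 (nonpos_of_mul_nonpos_right this (by linarith))
    let e := LinearEquiv.ofInjective Ψ hinj
    let τ' : StrongDual ℝ (LinearMap.range Ψ) :=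
      (τ ∘ₗ e.symm.toLinearMap).mkContinuous (s / (1 - η)) (by
        intro z
        obtain ⟨R, rfl⟩ := e.surjective z
        have h1 : ‖e R‖ = ‖Ψ R‖ := rfl
        simp only [LinearMap.comp_apply, LinearEquiv.coe_coe, LinearEquiv.symm_apply_apply,
          Real.norm_eq_abs, h1]
        rw [div_mul_eq_mul_div, le_div_iff₀ (by linarith)]
        calc |τ R| * (1 - η) ≤ s * ‖R‖ * (1 - η) :=
              mul_le_mul_of_nonneg_right (hτ R) (by linarith)
          _ = s * ((1 - η) * ‖R‖) := by ring
          _ ≤ s * ‖Ψ R‖ := mul_le_mul_of_nonneg_left (hΨ R) hs)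
    -- The components of the extension `g` give a cheap representation of the tensor.
    obtain ⟨g, hg, hgn⟩ := exists_extension_norm_eq (LinearMap.range Ψ) τ'
    have hgs : ‖g‖ ≤ s / (1 - η) := by
      rw [hgn]
      exact LinearMap.mkContinuous_norm_le _ (div_nonneg hs (by linarith)) _
    have hgΨ : ∀ R, τ R = ∑ k : t, (g ∘L ContinuousLinearMap.single ℝ (fun _ => V) k) (R k) := by
      intro R
      have h1 : g (Ψ R) = τ R := by
        have := hg (e R)
        simpa [τ', e] using this
      rw [← h1]
      simp only [ContinuousLinearMap.comp_apply, ContinuousLinearMap.single_apply]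
      rw [← map_sum, ← Finset.univ_sum_single (Ψ R)]
      rfl
    have heq := trace_eq_of_forall j f φ (fun k : t => (k : F)) _ hgΨ
    have hle := sum_bidual_le g (fun k : t => j k) fun k =>
      (j.le_of_opNorm_le hj _).trans (by simpa using ht1 k k.2)
    rw [← heq] at hle
    have := hle.trans hgs
    rwa [le_div_iff₀ (by linarith), mul_comm] at this
  refine le_of_tendsto (f := fun η : ℝ => (1 - η) * ∑ i, j (f i) (φ i)) (x := 𝓝[>] 0) ?_ ?_
  · have : Filter.Tendsto (fun η : ℝ => (1 - η) * ∑ i, j (f i) (φ i)) (𝓝 0)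
        (𝓝 ((1 - 0) * ∑ i, j (f i) (φ i))) :=
      ((continuous_const.sub continuous_id).mul continuous_const).tendsto 0
    simpa using this.mono_left nhdsWithin_le_nhds
  · filter_upwards [Ioo_mem_nhdsGT (zero_lt_one (α := ℝ))] with η hη
    exact main η hη.1 hη.2

/-- Weak local reflexivity: on finitely many pairs `(y i, φ i)`, a finite rank contraction `Y → V**`
is approximated by contractions `Y → V`. -/
lemma finiteRank_mem_closure (G : Y →L[ℝ] Bidual V) (hG : ‖G‖ ≤ 1)
    (hfin : FiniteDimensional ℝ (LinearMap.range G.toLinearMap))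
    {ι : Type*} [Fintype ι] (y : ι → Y) (φ : ι → StrongDual ℝ V) :
    (fun i => G (y i) (φ i)) ∈
      closure ((fun (T : Y →L[ℝ] V) i => φ i (T (y i))) '' Metric.closedBall 0 1) := by
  classical
  by_contra hcon
  have hconv : Convex ℝ ((fun (T : Y →L[ℝ] V) i => φ i (T (y i))) '' Metric.closedBall 0 1) := by
    refine (convex_closedBall (0 : Y →L[ℝ] V) 1).is_linear_image ⟨?_, ?_⟩
    · intro S T; ext i; simp
    · intro c T; ext i; simp
  obtain ⟨a, s, has, hsa⟩ := geometric_hahn_banach_closed_point hconv.closure isClosed_closure hcon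
  have ha : ∀ q : ι → ℝ, a q = ∑ i, a (Pi.single i 1) * q i := by
    intro q
    conv_lhs => rw [← Finset.univ_sum_single q, map_sum]
    refine Finset.sum_congr rfl fun i _ => ?_
    have : (Pi.single i (q i) : ι → ℝ) = q i • Pi.single i 1 := by
      rw [← Pi.single_smul]; simp
    rw [this, map_smul, smul_eq_mul, mul_comm]
  -- Operators on the range of `G`, composed with `G`, are enough to contradict the separation.
  let G' : Y →L[ℝ] LinearMap.range G.toLinearMap :=
    G.codRestrict _ fun x => LinearMap.mem_range_self G.toLinearMap x
  have hG' : ‖G'‖ ≤ 1 :=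
    G'.opNorm_le_bound zero_le_one fun x => G.le_of_opNorm_le hG x
  have := trace_le_of_forall (LinearMap.range G.toLinearMap).subtypeL
    (Submodule.norm_subtypeL_le _) (fun i => G' (y i))
    (fun i => a (Pi.single i 1) • φ i) (s := s) (by
      intro R hR
      have hRG : ‖R ∘L G'‖ ≤ 1 :=
        (R.opNorm_comp_le G').trans (mul_le_one₀ hR (norm_nonneg _) hG')
      have h1 := has _ (subset_closure ⟨R ∘L G', by simpa using hRG, rfl⟩)
      rw [ha] at h1
      simpa using h1.le)
  rw [ha] at hsa
  refine absurd this (not_le.2 ?_)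
  simpa [G'] using hsa

/-- Goldstine's theorem for finitely many functionals: the case `Y = ℝ` of
`finiteRank_mem_closure`. -/
lemma goldstine_mem_closure (u : Bidual V) (hu : ‖u‖ ≤ 1)
    {ι : Type*} [Fintype ι] (φ : ι → StrongDual ℝ V) :
    (fun i => u (φ i)) ∈ closure ((fun (x : V) i => φ i x) '' Metric.closedBall 0 1) := by
  have h := finiteRank_mem_closure (ContinuousLinearMap.toSpanSingleton ℝ u)
    (by simpa using hu) inferInstance (fun _ : ι => (1 : ℝ)) φ
  simp only [ContinuousLinearMap.toSpanSingleton_apply, one_smul] at h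
  refine closure_mono ?_ h
  rintro _ ⟨T, hT, rfl⟩
  refine ⟨T 1, ?_, rfl⟩
  simpa using T.le_of_opNorm_le (by simpa using hT) 1

end LocalReflexivity

/-! ### Duality between `X ⊗ Y` and operators from `Y` to the dual of `X` -/

section Pairing

variable {X Y : Type*} [NormedAddCommGroup X] [NormedSpace ℝ X]
  [NormedAddCommGroup Y] [NormedSpace ℝ Y]

/-- The functional on `X ⊗ Y` given by `T : Y → X*`, with `⟨T, x ⊗ y⟩ = T(y)(x)`. -/
def pairing (T : Y →L[ℝ] StrongDual ℝ X) : X ⊗[ℝ] Y →ₗ[ℝ] ℝ :=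
  TensorProduct.lift (LinearMap.mk₂ ℝ (fun x y => T y x) (by simp) (by simp) (by simp) (by simp))

@[simp]
lemma pairing_tmul (T : Y →L[ℝ] StrongDual ℝ X) (x : X) (y : Y) :
    pairing T (x ⊗ₜ y) = T y x := by
  simp [pairing]

lemma pairing_le_projNorm (T : Y →L[ℝ] StrongDual ℝ X) (hT : ‖T‖ ≤ 1) (w : X ⊗[ℝ] Y) :
    pairing T w ≤ projNorm w := by
  refine le_csInf (projCosts_nonempty w) ?_
  rintro _ ⟨n, x, y, rfl, rfl⟩
  rw [map_sum]
  refine Finset.sum_le_sum fun i _ => ?_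
  rw [pairing_tmul]
  calc T (y i) (x i) ≤ ‖T (y i) (x i)‖ := le_abs_self _
    _ ≤ ‖y i‖ * ‖x i‖ :=
        (T (y i)).le_of_opNorm_le ((T.le_of_opNorm_le hT _).trans (by simp)) _
    _ = ‖x i‖ * ‖y i‖ := mul_comm _ _

lemma projNorm_tmul_le (x : X) (y : Y) : projNorm (x ⊗ₜ[ℝ] y) ≤ ‖x‖ * ‖y‖ :=
  csInf_le (projCosts_bddBelow _) ⟨1, fun _ => x, fun _ => y, by simp, by simp⟩

variable (X Y) in
/-- The canonical map of the algebraic tensor product into the projective tensor product. -/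
def toProjTensor : X ⊗[ℝ] Y →ₗ[ℝ] ProjTensor X Y :=
  (UniformSpace.Completion.toComplL (𝕜 := ℝ) (E := ProjAlg X Y)).toLinearMap

lemma norm_toProjTensor (w : X ⊗[ℝ] Y) : ‖toProjTensor X Y w‖ = projNorm w :=
  UniformSpace.Completion.norm_coe (E := ProjAlg X Y) w

lemma denseRange_toProjTensor : DenseRange (toProjTensor X Y) :=
  UniformSpace.Completion.denseRange_coe (α := ProjAlg X Y)

lemma exists_pairing_eq_projNorm (w : X ⊗[ℝ] Y) :
    ∃ B : Y →L[ℝ] StrongDual ℝ X, ‖B‖ ≤ 1 ∧ pairing B w = projNorm w := by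
  obtain ⟨g, hg, hgw⟩ := exists_dual_vector'' ℝ (toProjTensor X Y w)
  let B : Y →L[ℝ] StrongDual ℝ X :=
    LinearMap.mkContinuous₂
      (LinearMap.mk₂ ℝ (fun y x => g (toProjTensor X Y (x ⊗ₜ y)))
        (by simp [TensorProduct.tmul_add]) (by simp)
        (by simp [TensorProduct.add_tmul])
        (by simp [← TensorProduct.smul_tmul'])) 1 (by
      intro y x
      have h1 := g.le_of_opNorm_le hg (toProjTensor X Y (x ⊗ₜ y))
      rw [norm_toProjTensor] at h1
      have h2 := projNorm_tmul_le x y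
      simp only [LinearMap.mk₂_apply]
      linarith)
  have hB : pairing B = g.toLinearMap ∘ₗ toProjTensor X Y := by
    ext x y
    simp [B]
  refine ⟨B, LinearMap.mkContinuous₂_norm_le _ zero_le_one _, ?_⟩
  rw [hB, ← norm_toProjTensor]
  simpa using hgw

end Pairing

/-! ### A criterion for octahedrality -/

section Octahedral

variable {W : Type*} [NormedAddCommGroup W] [NormedSpace ℝ W]

/-- If `‖w + y‖` is almost `2`, then the unit vectors `w` and `y` almost span the positive cone of a
two-dimensional `ℓ₁`. -/
lemma one_sub_mul_add_le_norm_smul_add {w y : W} {δ a b : ℝ} (hw : ‖w‖ = 1) (hy : ‖y‖ = 1)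
    (h : 2 - δ ≤ ‖w + y‖) (hδ : 0 ≤ δ) (ha : 0 ≤ a) (hb : 0 ≤ b) :
    (1 - δ) * (a + b) ≤ ‖a • w + b • y‖ := by
  rcases le_total a b with hab | hab
  · have h1 : b * ‖w + y‖ ≤ ‖a • w + b • y‖ + (b - a) := by
      calc b * ‖w + y‖ = ‖(a • w + b • y) + (b - a) • w‖ := by
            rw [← abs_of_nonneg hb, ← Real.norm_eq_abs, ← norm_smul, Real.norm_eq_abs,
              abs_of_nonneg hb]
            congr 1; module
        _ ≤ _ := (norm_add_le _ _).trans (by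
            rw [norm_smul, hw, Real.norm_eq_abs, abs_of_nonneg (sub_nonneg.2 hab), mul_one])
    nlinarith [mul_le_mul_of_nonneg_left h hb, mul_nonneg hδ ha]
  · have h1 : a * ‖w + y‖ ≤ ‖a • w + b • y‖ + (a - b) := by
      calc a * ‖w + y‖ = ‖(a • w + b • y) + (a - b) • y‖ := by
            rw [← abs_of_nonneg ha, ← Real.norm_eq_abs, ← norm_smul, Real.norm_eq_abs,
              abs_of_nonneg ha]
            congr 1; module
        _ ≤ _ := (norm_add_le _ _).trans (by
            rw [norm_smul, hy, Real.norm_eq_abs, abs_of_nonneg (sub_nonneg.2 hab), mul_one])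
    nlinarith [mul_le_mul_of_nonneg_left h ha, mul_nonneg hδ hb]

/-- It suffices to test finite subsets of a dense set `D`, a single positive multiple of the
direction `y`, and directions in the unit ball instead of the unit sphere. -/
lemma isOctahedral_of_dense {D : Set W} (hD : Dense D)
    (h : ∀ t : Finset W, ↑t ⊆ D → ∀ δ : ℝ, 0 < δ →
      ∃ y : W, ‖y‖ ≤ 1 ∧ ∀ w ∈ t, ‖w‖ + 1 - δ ≤ ‖w + y‖) :
    IsOctahedral W := by
  classical
  intro E hE ε hε
  obtain ⟨δ, hδ, hδ1, hδε⟩ : ∃ δ : ℝ, 0 < δ ∧ δ < 1 ∧ 4 * δ ≤ ε :=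
    ⟨min ε 1 / 4, by positivity, by linarith [min_le_right ε 1], by linarith [min_le_left ε 1]⟩
  have hcomp : IsCompact ((↑) '' Metric.sphere (0 : E) 1 : Set W) := by
    have : ProperSpace E := FiniteDimensional.proper_real E
    exact (isCompact_sphere (0 : E) 1).image continuous_subtype_val
  obtain ⟨t, htD, htf, hcov⟩ := hcomp.elim_finite_subcover_image (b := D)
    (c := fun d => Metric.ball d δ) (fun _ _ => Metric.isOpen_ball) (fun x _ => by
      obtain ⟨d, hd, hxd⟩ := hD.exists_dist_lt x hδ
      exact Set.mem_iUnion₂.2 ⟨d, hd, hxd⟩)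
  -- A point `d₀` keeps the finite set non-empty, which forces `‖y‖` to be close to `1`.
  obtain ⟨d₀, hd₀⟩ := hD.nonempty
  obtain ⟨y, hy, hty⟩ := h (insert d₀ htf.toFinset) (by
    intro d hd
    rcases Finset.mem_insert.1 (Finset.mem_coe.1 hd) with rfl | hd
    · exact hd₀
    · exact htD (htf.mem_toFinset.1 hd)) δ hδ
  have hy1 : 1 - δ ≤ ‖y‖ := by
    linarith [hty d₀ (Finset.mem_insert_self _ _), norm_add_le d₀ y]
  have hy0 : 0 < ‖y‖ := by linarith
  have hynorm : ‖‖y‖⁻¹ • y‖ = 1 := by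
    rw [norm_smul, norm_inv, norm_norm, inv_mul_cancel₀ hy0.ne']
  have hyy : ‖y - ‖y‖⁻¹ • y‖ ≤ δ := by
    have : y - ‖y‖⁻¹ • y = (‖y‖ - 1) • (‖y‖⁻¹ • y) := by
      rw [sub_smul, smul_smul, mul_inv_cancel₀ hy0.ne', one_smul, one_smul]
    rw [this, norm_smul, hynorm, mul_one, Real.norm_eq_abs, abs_le]
    constructor <;> linarith
  have hsphere : ∀ x ∈ E, ‖x‖ = 1 → 2 - 4 * δ ≤ ‖x + ‖y‖⁻¹ • y‖ := by
    intro x hxE hx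
    obtain ⟨d, hd, hxd⟩ := Set.mem_iUnion₂.1 (hcov ⟨⟨x, hxE⟩, by simpa using hx, rfl⟩)
    have h1 : ‖d - x‖ ≤ δ := by
      rw [← dist_eq_norm, dist_comm]; exact (Metric.mem_ball.1 hxd).le
    have h2 := hty d (Finset.mem_insert_of_mem (htf.mem_toFinset.2 hd))
    have h3 : ‖d + y‖ ≤ ‖x + ‖y‖⁻¹ • y‖ + ‖d - x‖ + ‖y - ‖y‖⁻¹ • y‖ := by
      have : d + y = (x + ‖y‖⁻¹ • y) + (d - x) + (y - ‖y‖⁻¹ • y) := by abel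
      rw [this]
      exact norm_add₃_le
    have h4 : ‖x‖ ≤ ‖d‖ + ‖d - x‖ := by
      rw [norm_sub_rev]
      simpa using norm_add_le d (x - d)
    linarith
  have hpos : ∀ x ∈ E, ∀ t : ℝ, 0 ≤ t →
      (1 - ε) * (‖x‖ + |t|) ≤ ‖x + t • (‖y‖⁻¹ • y)‖ := by
    intro x hx t ht
    rw [abs_of_nonneg ht]
    refine (mul_le_mul_of_nonneg_right (by linarith : 1 - ε ≤ 1 - 4 * δ)
      (by positivity)).trans ?_
    rcases eq_or_ne x 0 with rfl | hx0
    · rw [zero_add, norm_smul, hynorm, norm_zero, zero_add, Real.norm_eq_abs, abs_of_nonneg ht]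
      nlinarith
    · have hxn : 0 < ‖x‖ := norm_pos_iff.2 hx0
      have hx1 : ‖‖x‖⁻¹ • x‖ = 1 := by
        rw [norm_smul, norm_inv, norm_norm, inv_mul_cancel₀ hxn.ne']
      have := one_sub_mul_add_le_norm_smul_add hx1 hynorm (hsphere _ (E.smul_mem _ hx) hx1)
        (by positivity) hxn.le ht
      rwa [smul_smul, mul_inv_cancel₀ hxn.ne', one_smul] at this
  refine ⟨‖y‖⁻¹ • y, hynorm, fun x hx t => ?_⟩
  rcases le_total 0 t with ht | ht
  · exact hpos x hx t ht
  · have := hpos (-x) (E.neg_mem hx) (-t) (neg_nonneg.2 ht)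
    rwa [norm_neg, abs_neg, neg_smul, ← neg_add, norm_neg] at this

end Octahedral

/-! ### Using the metric approximation property -/

section Approximation

variable {X Y : Type*} [NormedAddCommGroup X] [NormedSpace ℝ X]
  [NormedAddCommGroup Y] [NormedSpace ℝ Y]

/-- The operator `y ↦ G y ∘ S` has finite rank as soon as `S` does, since `G y ∘ S` depends only on
the restriction of `G y` to the range of `S`. -/
lemma finiteDimensional_range_comp {V : Type*} [NormedAddCommGroup V] [NormedSpace ℝ V]
    (G : Y →L[ℝ] StrongDual ℝ V) (S : V →L[ℝ] V)
    (hS : FiniteDimensional ℝ (LinearMap.range S.toLinearMap)) :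
    FiniteDimensional ℝ (LinearMap.range
      ((ContinuousLinearMap.compL ℝ V V ℝ).flip S ∘L G).toLinearMap) := by
  let S' : V →L[ℝ] LinearMap.range S.toLinearMap :=
    S.codRestrict _ fun x => LinearMap.mem_range_self S.toLinearMap x
  let L : (LinearMap.range S.toLinearMap →L[ℝ] ℝ) →ₗ[ℝ] StrongDual ℝ V :=
    ((ContinuousLinearMap.compL ℝ V (LinearMap.range S.toLinearMap) ℝ).flip S').toLinearMap
  refine Submodule.finiteDimensional_of_le (S₂ := LinearMap.range L) ?_
  rintro _ ⟨y, rfl⟩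
  exact ⟨(G y) ∘L (LinearMap.range S.toLinearMap).subtypeL, rfl⟩

/-- On finitely many pairs `(y i, u i)` in `Y × X**`, any contraction `Y → X***` is approximated by
contractions `Y → X*`: composition with the approximating operators, on either side, makes it of
finite rank. -/
lemma mem_closure_of_hasMAP (hMAP : HasMAP (Bidual X) ∨ HasMAP Y)
    (G : Y →L[ℝ] Bidual (StrongDual ℝ X)) (hG : ‖G‖ ≤ 1)
    {ι : Type*} [Fintype ι] (y : ι → Y) (u : ι → Bidual X) :
    (fun i => G (y i) (u i)) ∈
      closure ((fun (T : Y →L[ℝ] StrongDual ℝ X) i => u i (T (y i))) ''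
        Metric.closedBall 0 1) := by
  rcases hMAP with ⟨κ, _, _, _, S, hSfin, hS1, hS⟩ | ⟨κ, _, _, _, S, hSfin, hS1, hS⟩
  · refine isClosed_closure.mem_of_tendsto (b := Filter.atTop)
      (f := fun α i => G (y i) (S α (u i))) (tendsto_pi_nhds.2 fun i => ?_)
      (Filter.Eventually.of_forall fun α => ?_)
    · exact ((G (y i)).continuous.tendsto (u i)).comp (hS (u i))
    let GS : Y →L[ℝ] Bidual (StrongDual ℝ X) :=
      (ContinuousLinearMap.compL ℝ (Bidual X) (Bidual X) ℝ).flip (S α) ∘L G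
    refine finiteRank_mem_closure GS ?_ (finiteDimensional_range_comp G (S α) (hSfin α)) y u
    refine ContinuousLinearMap.opNorm_le_bound _ zero_le_one fun z => ?_
    refine ((G z).opNorm_comp_le (S α)).trans ?_
    rw [one_mul]
    have h1 : ‖G z‖ ≤ ‖z‖ := by simpa using G.le_of_opNorm_le hG z
    calc ‖G z‖ * ‖S α‖ ≤ ‖z‖ * 1 := mul_le_mul h1 (hS1 α) (norm_nonneg _) (norm_nonneg _)
      _ = ‖z‖ := mul_one _
  · refine isClosed_closure.mem_of_tendsto (b := Filter.atTop)
      (f := fun α i => G (S α (y i)) (u i)) (tendsto_pi_nhds.2 fun i => ?_)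
      (Filter.Eventually.of_forall fun α => ?_)
    · have hc : Continuous fun z => G z (u i) := by fun_prop
      exact (hc.tendsto (y i)).comp (hS (y i))
    · refine finiteRank_mem_closure (G ∘L S α)
        ((G.opNorm_comp_le _).trans (mul_le_one₀ hG (norm_nonneg _) (hS1 α))) ?_ y u
      have := hSfin α
      have h : LinearMap.range (G ∘L S α).toLinearMap =
          (LinearMap.range (S α).toLinearMap).map G.toLinearMap :=
        LinearMap.range_comp _ _
      rw [h]
      infer_instance

end Approximation

/-! ### Octahedral directions for `L`-embedded spaces -/

section LEmbedded

variable {X Y : Type*} [NormedAddCommGroup X] [NormedSpace ℝ X]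
  [NormedAddCommGroup Y] [NormedSpace ℝ Y]

/-- In the complement of an `L`-embedded space there is a unit vector `u` such that every contraction
`Y → X*`, seen as a bilinear form on `X × Y`, extends to `X** × Y` without increase of norm and with
a prescribed contractive value at `u`. -/
lemma exists_extension_of_isLEmbedded (hL : IsLEmbedded X) (hrefl : ¬ IsReflexive X) :
    ∃ u : Bidual X, ‖u‖ = 1 ∧ ∀ (B : Y →L[ℝ] StrongDual ℝ X) (g : StrongDual ℝ Y),
      ‖B‖ ≤ 1 → ‖g‖ ≤ 1 → ∃ G : Y →L[ℝ] Bidual (StrongDual ℝ X), ‖G‖ ≤ 1 ∧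
        (∀ x y, G y (NormedSpace.inclusionInDoubleDual ℝ X x) = B y x) ∧
        ∀ y, G y u = g y := by
  obtain ⟨Z, hZ, hnorm⟩ := hL
  set J := NormedSpace.inclusionInDoubleDual ℝ X
  obtain ⟨z, hz, hz0⟩ : ∃ z ∈ Z, z ≠ 0 := by
    by_contra! hcon
    refine hrefl (LinearMap.range_eq_top.1 (?_ : LinearMap.range J.toLinearMap = ⊤))
    have : Z = ⊥ := (Submodule.eq_bot_iff _).2 hcon
    simpa [this] using hZ.sup_eq_top
  have hzn : 0 < ‖z‖ := norm_pos_iff.2 hz0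
  have hu : ‖‖z‖⁻¹ • z‖ = 1 := by
    rw [norm_smul, norm_inv, norm_norm, inv_mul_cancel₀ hzn.ne']
  have huZ : ‖z‖⁻¹ • z ∈ Z := Z.smul_mem _ hz
  set u := ‖z‖⁻¹ • z
  refine ⟨u, hu, fun B g hB hg => ?_⟩
  obtain ⟨ζ, hζ, hζu⟩ := exists_dual_vector'' ℝ u
  have hJinj : Function.Injective J := (NormedSpace.inclusionInDoubleDualLi ℝ (E := X)).injective
  let e : X ≃ₗ[ℝ] LinearMap.range J.toLinearMap := LinearEquiv.ofInjective J.toLinearMap hJinj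
  let P : Bidual X →ₗ[ℝ] X :=
    e.symm.toLinearMap ∘ₗ Submodule.projectionOnto _ Z hZ
  let Q : Bidual X →ₗ[ℝ] Z := Submodule.projectionOnto Z _ hZ.symm
  have hP : ∀ v, J (P v) + Q v = v := by
    intro v
    have h1 : J (P v) = Submodule.projectionOnto _ Z hZ v :=
      congrArg Subtype.val (e.apply_symm_apply (Submodule.projectionOnto _ Z hZ v))
    rw [h1]
    exact Submodule.projection_add_projection_eq_self hZ v
  have hPQ : ∀ v, ‖P v‖ + ‖Q v‖ = ‖v‖ := by
    intro v
    have h1 := hnorm (P v) (Q v) (Q v).2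
    rw [hP v] at h1
    have h2 : ‖J (P v)‖ = ‖P v‖ := (NormedSpace.inclusionInDoubleDualLi ℝ (E := X)).norm_map _
    rw [h1, h2]
    rfl
  have hPJ : ∀ x, P (J x) = x := by
    intro x
    have h1 : J x = (e x : Bidual X) := rfl
    simp only [P, LinearMap.comp_apply, h1, Submodule.projectionOnto_apply_left]
    exact e.symm_apply_apply x
  have hQJ : ∀ x, Q (J x) = 0 := by
    intro x
    have h1 : J x = (e x : Bidual X) := rfl
    simp only [Q, h1, Submodule.projectionOnto_apply_right]
  have hPu : P u = 0 := by
    have := Submodule.projectionOnto_apply_right hZ ⟨u, huZ⟩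
    simp only [P, LinearMap.comp_apply, this, map_zero]
  have hQu : (Q u : Bidual X) = u :=
    congrArg Subtype.val (Submodule.projectionOnto_apply_left hZ.symm ⟨u, huZ⟩)
  let G : Y →L[ℝ] Bidual (StrongDual ℝ X) :=
    LinearMap.mkContinuous₂
      (LinearMap.mk₂ ℝ (fun y v => B y (P v) + g y * ζ (Q v))
        (by intros; simp; ring) (by intros; simp; ring)
        (by intros; simp; ring) (by intros; simp; ring)) 1 (by
      intro y v
      simp only [LinearMap.mk₂_apply, one_mul]
      have hBy : ‖B y‖ ≤ ‖y‖ := by simpa using B.le_of_opNorm_le hB y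
      have hgy : ‖g y‖ ≤ ‖y‖ := by simpa using g.le_of_opNorm_le hg y
      have hζv : ‖ζ (Q v)‖ ≤ ‖Q v‖ := by simpa using ζ.le_of_opNorm_le hζ (Q v)
      calc ‖B y (P v) + g y * ζ (Q v)‖ ≤ ‖B y (P v)‖ + ‖g y‖ * ‖ζ (Q v)‖ := by
            rw [← norm_mul]; exact norm_add_le _ _
        _ ≤ ‖y‖ * ‖P v‖ + ‖y‖ * ‖Q v‖ := by
            gcongr
            exact (B y).le_of_opNorm_le hBy _
        _ = ‖y‖ * ‖v‖ := by rw [← mul_add, hPQ])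
  refine ⟨G, LinearMap.mkContinuous₂_norm_le _ zero_le_one _, fun x y => ?_, fun y => ?_⟩
  · simp [G, hPJ, hQJ]
  · simp [G, hPu, hQu, hζu, hu]

/-- If `G : Y → X***` extends `B`, then its values on `w ∈ X ⊗ Y` and on `u ⊗ y₀ ∈ X** ⊗ Y` are
almost attained by a contraction `T : Y → X*`. -/
lemma exists_pairing_gt (hMAP : HasMAP (Bidual X) ∨ HasMAP Y) (w : X ⊗[ℝ] Y)
    (G : Y →L[ℝ] Bidual (StrongDual ℝ X)) (hG : ‖G‖ ≤ 1) (B : Y →L[ℝ] StrongDual ℝ X)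
    (hGB : ∀ x y, G y (NormedSpace.inclusionInDoubleDual ℝ X x) = B y x)
    (u : Bidual X) (y₀ : Y) {δ : ℝ} (hδ : 0 < δ) :
    ∃ T : Y →L[ℝ] StrongDual ℝ X, ‖T‖ ≤ 1 ∧ pairing B w - δ < pairing T w ∧
      G y₀ u - δ < u (T y₀) := by
  -- The pairs are `(y i, x i)`, for a representation of `w`, and `(y₀, u)` at the index `none`.
  obtain ⟨n, x, y, rfl, -⟩ := (projCosts_nonempty w).some_mem
  have h := mem_closure_of_hasMAP hMAP G hG (ι := Option (Fin n)) (fun o => o.elim y₀ y)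
    (fun o => o.elim u fun i => NormedSpace.inclusionInDoubleDual ℝ X (x i))
  let O : Set (Option (Fin n) → ℝ) :=
    {q | ∑ i, G (y i) (NormedSpace.inclusionInDoubleDual ℝ X (x i)) - δ < ∑ i, q (some i)} ∩
      {q | G y₀ u - δ < q none}
  have hO : IsOpen O :=
    (isOpen_lt continuous_const (by fun_prop)).inter (isOpen_lt continuous_const (by fun_prop))
  obtain ⟨_, ⟨h1, h2⟩, T, hT, rfl⟩ := mem_closure_iff.1 h O hO ⟨by simp [hδ], by simp [hδ]⟩
  refine ⟨T, by simpa using hT, ?_, h2⟩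
  simpa [hGB] using h1

/-- For finitely many tensors there is an elementary tensor `x ⊗ y` in the unit ball which is almost
`ℓ₁`-orthogonal to all of them. -/
lemma exists_projNorm_add_tmul_ge [Nontrivial Y] (hL : IsLEmbedded X) (hrefl : ¬ IsReflexive X)
    (hMAP : HasMAP (Bidual X) ∨ HasMAP Y) {κ : Type*} [Fintype κ] (w : κ → X ⊗[ℝ] Y)
    {δ : ℝ} (hδ : 0 < δ) :
    ∃ (x : X) (y : Y), projNorm (x ⊗ₜ[ℝ] y) ≤ 1 ∧
      ∀ k, projNorm (w k) + 1 - δ ≤ projNorm (w k + x ⊗ₜ[ℝ] y) := by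
  obtain ⟨u, hu, hext⟩ := exists_extension_of_isLEmbedded (Y := Y) hL hrefl
  obtain ⟨y₀, hy₀⟩ := exists_norm_eq Y zero_le_one
  obtain ⟨g, hg, hgy⟩ := exists_dual_vector'' ℝ y₀
  have hT : ∀ k, ∃ T : Y →L[ℝ] StrongDual ℝ X, ‖T‖ ≤ 1 ∧
      projNorm (w k) - δ / 3 < pairing T (w k) ∧ 1 - δ / 3 < u (T y₀) := by
    intro k
    obtain ⟨B, hB, hBw⟩ := exists_pairing_eq_projNorm (w k)
    obtain ⟨G, hG, hGB, hGu⟩ := hext B g hB hg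
    have h := exists_pairing_gt hMAP (w k) G hG B hGB u y₀ (δ := δ / 3) (by positivity)
    rw [hBw, hGu, hgy, hy₀] at h
    exact h
  choose T hT1 hTw hTu using hT
  have hO : IsOpen {q : κ → ℝ | ∀ k, u (T k y₀) - δ / 3 < q k} := by
    simp only [Set.ofPred_forall]
    exact isOpen_iInter_of_finite fun k => isOpen_lt continuous_const (continuous_apply k)
  obtain ⟨_, h1, x, hx, rfl⟩ := mem_closure_iff.1
    (goldstine_mem_closure u hu.le fun k => T k y₀) _ hO fun k => by linarith
  refine ⟨x, y₀, (projNorm_tmul_le x y₀).trans (by simpa [hy₀] using hx), fun k => ?_⟩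
  have h2 := pairing_le_projNorm (T k) (hT1 k) (w k + x ⊗ₜ y₀)
  rw [map_add, pairing_tmul] at h2
  linarith [hTw k, hTu k, h1 k]

end LEmbedded

end BanachTensor

end

theorem mainTheorem3 {X Y : Type*}
    [NormedAddCommGroup X] [NormedSpace ℝ X] [CompleteSpace X]
    [NormedAddCommGroup Y] [NormedSpace ℝ Y] [CompleteSpace Y] [Nontrivial Y]
    (hrefl : ¬ BanachTensor.IsReflexive X) (hL : BanachTensor.IsLEmbedded X)
    (hMAP : BanachTensor.HasMAP (BanachTensor.Bidual X) ∨ BanachTensor.HasMAP Y) :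
    BanachTensor.IsOctahedral (BanachTensor.ProjTensor X Y) := by
  refine BanachTensor.isOctahedral_of_dense BanachTensor.denseRange_toProjTensor
    fun t ht δ hδ => ?_
  choose! r hr using fun d (hd : d ∈ t) => ht hd
  obtain ⟨x, y, hxy, h⟩ := BanachTensor.exists_projNorm_add_tmul_ge hL hrefl hMAP
    (fun d : t => r d) hδ
  refine ⟨BanachTensor.toProjTensor X Y (x ⊗ₜ y),
    (BanachTensor.norm_toProjTensor _).trans_le hxy, fun d hd => ?_⟩
  have hd' := h ⟨d, hd⟩
  rwa [← BanachTensor.norm_toProjTensor, ← BanachTensor.norm_toProjTensor, map_add, hr d hd]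
    at hd'
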